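/- Let $T>0$ and let $A,B,C:\mathbb{R}\to\mathbb{R}$ be $\mathcal C^1$, $T$-periodic functions. Assume that $A$ has at least one zero in $[0,T]$ and that $$\min_t |B(t)|^2 > -4\,\min_t \dot A(t)\cdot\Bigl[1+T\max_t|C(t)|\Bigr].$$ Consider the equation $$x\dot x = A(t)+B(t)x+C(t)x^2. \qquad (*)$$ A solution of $(*)$ is a continuous function $x:\mathbb{R}\to\mathbb{R}$ which, at every $t$ with $x(t)\neq 0$, is differentiable and satisfies $(*)$, and for which $A(t)=0$ at every $t$ with $x(t)=0$ (so that $(*)$ holds there as well); for differentiable $x$ this just means that $(*)$ holds at every $t$. A function has nonconstant sign if it has at least one zero. Then: (1) every $T$-periodic solution $x$ of $(*)$ with nonconstant sign has the sign of $-A(t)B(t)$, that is, $\operatorname{sgn} x(t)=\operatorname{sgn}(-A(t)B(t))$ for all $t\in\mathbb{R}$; (2) if moreover all the zeros of $A$ are simple (that is, $\dot A(t)\neq 0$ whenever $A(t)=0$), then $(*)$ has exactly one $\mathcal C^1$, $T$-periodic solution with nonconstant sign. -/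

import Mathlib

/-- `IsSolution A B C x` : the function `x : ℝ → ℝ` is a solution on the whole line of
`x ẋ = A(t) + B(t) x + C(t) x²`.
The function is continuous and the equation holds at every time `t`; the derivative is required
to exist wherever its coefficient `x t` does not vanish (where `x t = 0` the left-hand side is `0`,
whatever value `v` is inserted for the derivative).  In particular every differentiable
function that satisfies the equation at every `t` is a solution, and a differentiable function is a
solution only if it satisfies the equation at every `t`, see `isSolution_iff`. -/
def IsSolution (A B C x : ℝ → ℝ) : Prop :=
  Continuous x ∧ ∀ t : ℝ, ∃ v : ℝ, (x t ≠ 0 → HasDerivAt x v t) ∧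
    x t * v = A t + B t * x t + C t * x t ^ 2

/-- For differentiable functions (in particular for functions of class `C¹`), `IsSolution` is the
classical notion of solution. -/
theorem isSolution_iff {A B C x : ℝ → ℝ} (hx : Differentiable ℝ x) :
    IsSolution A B C x ↔ ∀ t : ℝ, x t * deriv x t = A t + B t * x t + C t * x t ^ 2 := by
  constructor
  · rintro ⟨-, h⟩ t
    obtain ⟨v, hv, he⟩ := h t
    by_cases h0 : x t = 0
    · rw [← he, h0]; simp
    · rw [(hv h0).deriv, he]
  · intro h
    exact ⟨hx.continuous, fun t => ⟨deriv x t, fun _ => (hx t).hasDerivAt, h t⟩⟩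

/-- A function has constant sign if it vanishes nowhere; it has nonconstant sign
if it has at least one zero. -/
def HasNonconstantSign (x : ℝ → ℝ) : Prop :=
  ∃ t : ℝ, x t = 0

/-- `x` has the sign (positive, zero or negative) of `f` at every time. -/
def HasSignOf (x f : ℝ → ℝ) : Prop :=
  ∀ t : ℝ, SignType.sign (x t) = SignType.sign (f t)

/-!
The two symmetries `x ↦ -x` (which flips `B`) and `x(t) ↦ -x(-t)` (which keeps `B`, exchanges the signs of `x`
and `A`, and preserves the hypothesis) allow every argument to be made for `B > 0` on an interval where
`x > 0`. The hypothesis forces `B` to have no zero, since `A`, being periodic, has `min Ȧ ≤ 0`.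

*Sign.* Put `μ = -min Ȧ`, `β = min |B|`, `c = max |C|`. The hypothesis is the positivity of the
discriminant of `r² (1 + c T) - β r + μ`, so some slope `l > 0` makes it negative. Then the ray
`l (t - τ)` issued from a point with `A τ ≥ 0` is a strict lower barrier during one period
(`PeriodicData.ray_lt`). A solution with `x τ > 0` and `A τ ≥ 0` would stay above it and could not vanish
again within a period, so a periodic solution with a zero has the sign of `-A` (`PeriodicData.sign_eq`).

*Uniqueness.* Where `A < 0`, the difference of two positive solutions satisfies
`(x - y)' = (x - y) (-A / (x y) + C)`, hence `(x - y)² exp (2 c t)` increases up to the next zero of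
`A`, where it is `0` (`PeriodicData.solution_unique`).

*Existence.* On a component `(a, b)` of `{A < 0}` the function `y = x² / 2` satisfies
`ẏ = A + B √(2 y) + 2 C y`, whose right-hand side is continuous. Smoothing the root and truncating gives
terminal value problems `y b = 0` solved by Picard–Lindelöf; their solutions are monotone in the smoothing parameter and
converge to a solution, which is positive because `A < 0` and vanishes at `a` because of the barrier
(`PeriodicData.exists_energy_arc`). The arcs and their reflections fit together to a continuous solution, which is
periodic by uniqueness (`PeriodicData.exists_solution`).

*Smoothness.* Near a simple zero `τ` of `A` the quotient `v = x / (t - τ)` is bounded, stays away from `0`, and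
satisfies `(t - τ) v̇ = (A / (t - τ)) / v + B + C x - v`. Almost every level is eventually crossed in one direction
only, so `v` converges, to a root of `m² = B m + Ȧ`. If `Ȧ > 0` it is the negative root on both sides of `τ`; if
`Ȧ < 0` the barrier gives `0 < m ≤ l`, which leaves only the smaller root. The one-sided
derivatives therefore agree (`PeriodicData.contDiff_of_simple_zeros`).
-/

open Set Filter Topology

/-! ### Crossing arguments, the barrier, and uniqueness -/

/-- A continuous function that is negative at `s` and nonnegative at `e` has a first zero. -/
theorem exists_first_zero {f : ℝ → ℝ} {s e : ℝ} (hse : s ≤ e) (hf : ContinuousOn f (Icc s e))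
    (hs : f s < 0) (he : 0 ≤ f e) :
    ∃ b, s < b ∧ b ≤ e ∧ f b = 0 ∧ ∀ t ∈ Ico s b, f t < 0 := by
  have hcl : IsClosed (Icc s e ∩ f ⁻¹' Ici 0) :=
    hf.preimage_isClosed_of_isClosed isClosed_Icc isClosed_Ici
  have hcp : IsCompact (Icc s e ∩ f ⁻¹' Ici 0) :=
    isCompact_Icc.of_isClosed_subset hcl inter_subset_left
  obtain ⟨b, ⟨hb, hb0⟩, hmin⟩ := hcp.exists_isLeast ⟨e, ⟨hse, le_rfl⟩, he⟩
  have hneg : ∀ t ∈ Ico s b, f t < 0 := by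
    intro t ht
    by_contra! h
    exact absurd (hmin ⟨⟨ht.1, ht.2.le.trans hb.2⟩, h⟩) (not_le.2 ht.2)
  have hsb : s < b := by
    rcases hb.1.lt_or_eq with h | h
    · exact h
    · subst h
      exact absurd hb0 (not_le.2 hs)
  refine ⟨b, hsb, hb.2, ?_, hneg⟩
  obtain ⟨t, ht, ht0⟩ := intermediate_value_Icc hb.1
    (hf.mono (Icc_subset_Icc_right hb.2)) ⟨hs.le, hb0⟩
  rcases ht.2.lt_or_eq with h | h
  · exact absurd ht0 (hneg t ⟨ht.1, h⟩).ne
  · rwa [← h]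

/-- The mirror image of `exists_first_zero`. -/
theorem exists_last_zero {f : ℝ → ℝ} {s e : ℝ} (hse : s ≤ e) (hf : ContinuousOn f (Icc s e))
    (he : f e < 0) (hs : 0 ≤ f s) :
    ∃ a, s ≤ a ∧ a < e ∧ f a = 0 ∧ ∀ t ∈ Ioc a e, f t < 0 := by
  obtain ⟨b, h1, h2, h3, h4⟩ := exists_first_zero (f := fun t => f (-t)) (s := -e) (e := -s)
    (neg_le_neg hse)
    (hf.comp continuousOn_neg fun t ht => ⟨by linarith [ht.2], by linarith [ht.1]⟩)
    (by simpa using he) (by simpa using hs)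
  refine ⟨-b, by linarith, by linarith, h3, fun t ht => ?_⟩
  simpa using h4 (-t) ⟨by linarith [ht.2], by linarith [ht.1]⟩

/-- A positive function that can cross the level `0` only upwards stays nonnegative. -/
theorem nonneg_of_deriv_pos_at_zeros {g : ℝ → ℝ} {s e : ℝ} (hse : s ≤ e)
    (hg : ContinuousOn g (Icc s e)) (hs : 0 < g s)
    (h : ∀ t ∈ Ioo s e, g t = 0 → ∃ d > 0, HasDerivAt g d t) : 0 ≤ g e := by
  by_contra! he
  obtain ⟨b, hsb, hbe, hb0, hb⟩ := exists_first_zero (f := fun t => -g t) hse hg.neg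
    (by linarith) (by linarith)
  have hb0' : g b = 0 := by linarith
  have hbe' : b < e := lt_of_le_of_ne hbe (by rintro rfl; linarith)
  obtain ⟨d, hd, hderiv⟩ := h b ⟨hsb, hbe'⟩ hb0'
  have h1 : ∀ᶠ z in 𝓝[<] b, 0 < slope g b z :=
    ((hasDerivAt_iff_tendsto_slope.1 hderiv).mono_left
      (nhdsWithin_mono b fun z hz => ne_of_lt hz)).eventually_const_lt hd
  have h2 : ∀ᶠ z in 𝓝[<] b, z ∈ Ioo s b := Ioo_mem_nhdsLT hsb
  obtain ⟨z, hz1, hz2⟩ := (h1.and h2).exists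
  rw [slope_def_field, hb0', sub_zero, div_pos_iff] at hz1
  have := hb z ⟨hz2.1.le, hz2.2⟩
  rcases hz1 with hz1 | hz1 <;> linarith [hz2.2, hz1.1, hz1.2]

/-- A function that increases wherever it is positive stays positive. -/
theorem pos_of_deriv_pos_of_pos {g : ℝ → ℝ} {s e : ℝ} (hse : s ≤ e)
    (hg : ContinuousOn g (Icc s e)) (hs : 0 < g s)
    (h : ∀ t ∈ Ioo s e, 0 < g t → ∃ d > 0, HasDerivAt g d t) : 0 < g e := by
  have := nonneg_of_deriv_pos_at_zeros (g := fun t => g t - g s / 2) hse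
    (hg.sub continuousOn_const) (by linarith) (by
      intro t ht h0
      obtain ⟨d, hd, hd'⟩ := h t ht (by linarith)
      exact ⟨d, hd, hd'.sub_const _⟩)
  linarith

/-- The equation `x ẋ = A + B x + C x²` with `T`-periodic coefficients, `A` having a zero, normalised so
that `B` is bounded below by `β > 0`. The number `l` is a slope for which every ray
`s ↦ l s`, `0 ≤ s ≤ T`, starting at a point with `A ≥ 0` is a strict lower barrier: `quad` is the inequality
`l < -μ / l + β - c l T`. -/
structure PeriodicData (T μ β c l : ℝ) (A B C : ℝ → ℝ) : Prop where
  T_pos : 0 < T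
  β_pos : 0 < β
  c_nonneg : 0 ≤ c
  l_pos : 0 < l
  contDiffA : ContDiff ℝ 1 A
  contB : Continuous B
  contC : Continuous C
  perA : Function.Periodic A T
  perB : Function.Periodic B T
  perC : Function.Periodic C T
  zero : ∃ t, A t = 0
  deriv_ge : ∀ t, -μ ≤ deriv A t
  le_B : ∀ t, β ≤ B t
  abs_C_le : ∀ t, |C t| ≤ c
  quad : l ^ 2 * (1 + c * T) + μ < β * l

theorem IsSolution.neg {A B C x : ℝ → ℝ} (h : IsSolution A B C x) :
    IsSolution A (fun t => -B t) C (fun t => -x t) := by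
  refine ⟨h.1.neg, fun t => ?_⟩
  obtain ⟨v, hv, he⟩ := h.2 t
  refine ⟨-v, fun h0 => (hv (by simpa using h0)).neg, ?_⟩
  linear_combination he

/-- The symmetry `x(t) ↦ -x(-t)`. -/
theorem IsSolution.reflect {A B C x : ℝ → ℝ} (h : IsSolution A B C x) :
    IsSolution (fun t => -A (-t)) (fun t => B (-t)) (fun t => -C (-t)) (fun t => -x (-t)) := by
  refine ⟨(h.1.comp continuous_neg).neg, fun t => ?_⟩
  obtain ⟨v, hv, he⟩ := h.2 (-t)
  refine ⟨v, fun h0 => ?_, ?_⟩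
  · have := ((hv (by simpa using h0)).scomp t (hasDerivAt_neg t)).fun_neg
    simpa [Function.comp_def] using this
  · linear_combination -he

theorem periodic_reflect {f : ℝ → ℝ} {T : ℝ} (h : Function.Periodic f T) :
    Function.Periodic (fun t => f (-t)) T := by
  intro t
  have := h (-(t + T))
  simp only [neg_add_rev, neg_add_cancel_comm] at this ⊢
  rw [← this]

theorem deriv_reflect (A : ℝ → ℝ) (t : ℝ) : deriv (fun s => -A (-s)) t = deriv A (-t) := by
  rw [deriv.fun_neg, deriv_comp_neg, neg_neg]

namespace PeriodicData

variable {T μ β c l : ℝ} {A B C x : ℝ → ℝ}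

theorem reflect (D : PeriodicData T μ β c l A B C) :
    PeriodicData T μ β c l (fun t => -A (-t)) (fun t => B (-t)) (fun t => -C (-t)) where
  T_pos := D.T_pos
  β_pos := D.β_pos
  c_nonneg := D.c_nonneg
  l_pos := D.l_pos
  contDiffA := (D.contDiffA.comp contDiff_neg).neg
  contB := D.contB.comp continuous_neg
  contC := (D.contC.comp continuous_neg).neg
  perA := fun t => congrArg Neg.neg (periodic_reflect D.perA t)
  perB := periodic_reflect D.perB
  perC := fun t => congrArg Neg.neg (periodic_reflect D.perC t)
  zero := by
    obtain ⟨t, ht⟩ := D.zero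
    exact ⟨-t, by simpa using ht⟩
  deriv_ge := fun t => by
    rw [deriv_reflect]
    exact D.deriv_ge _
  le_B := fun t => D.le_B _
  abs_C_le := fun t => by
    rw [abs_neg]
    exact D.abs_C_le _
  quad := D.quad

theorem contA (D : PeriodicData T μ β c l A B C) : Continuous A := D.contDiffA.continuous

theorem hasDerivAt_A (D : PeriodicData T μ β c l A B C) (t : ℝ) : HasDerivAt A (deriv A t) t :=
  (D.contDiffA.differentiable one_ne_zero t).hasDerivAt

theorem A_ge (D : PeriodicData T μ β c l A B C) {τ t : ℝ} (hτ : 0 ≤ A τ) (h : τ ≤ t) :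
    -μ * (t - τ) ≤ A t := by
  have := (convex_univ (𝕜 := ℝ) (E := ℝ)).mul_sub_le_image_sub_of_le_deriv
    D.contA.continuousOn (D.contDiffA.differentiable one_ne_zero).differentiableOn
    (fun t _ => D.deriv_ge t) τ (mem_univ _) t (mem_univ _) h
  linarith

/-- Along the ray of slope `l` issued from a point with `A ≥ 0`, the right-hand side of the
equation exceeds `x ẋ`. -/
theorem ray_lt (D : PeriodicData T μ β c l A B C) {τ t : ℝ} (hτ : 0 ≤ A τ) (h : τ < t)
    (hT : t ≤ τ + T) :
    l ^ 2 * (t - τ) < A t + B t * (l * (t - τ)) + C t * (l * (t - τ)) ^ 2 := by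
  have h1 := D.A_ge hτ h.le
  have hs : 0 < t - τ := sub_pos.2 h
  have hl := D.l_pos
  have h2 : β * (l * (t - τ)) ≤ B t * (l * (t - τ)) :=
    mul_le_mul_of_nonneg_right (D.le_B t) (by positivity)
  have h3 : -c * (l * (t - τ)) ^ 2 ≤ C t * (l * (t - τ)) ^ 2 :=
    mul_le_mul_of_nonneg_right (abs_le.1 (D.abs_C_le t)).1 (by positivity)
  have h4 : c * l ^ 2 * (t - τ) * (t - τ) ≤ c * l ^ 2 * (t - τ) * T :=
    mul_le_mul_of_nonneg_left (by linarith)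
      (mul_nonneg (mul_nonneg D.c_nonneg (sq_nonneg l)) hs.le)
  have h5 := mul_lt_mul_of_pos_right D.quad hs
  linarith

/-- A solution that is above the ray of slope `l` remains above it, hence has no zero within
the next period. -/
theorem le_ray (D : PeriodicData T μ β c l A B C) (hx : IsSolution A B C x) {τ t e : ℝ}
    (hτ : 0 ≤ A τ) (hτt : τ ≤ t) (hte : t < e) (heT : e ≤ τ + T) (he : x e = 0) :
    x t ≤ l * (t - τ) := by
  by_contra! hlt
  have := nonneg_of_deriv_pos_at_zeros (g := fun s => x s - l * (s - τ)) hte.le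
    (by have := hx.1; fun_prop) (by linarith) (by
      intro s hs h0
      have hsτ : 0 < s - τ := by linarith [hs.1]
      have hxs : x s = l * (s - τ) := by linarith
      have hpos : 0 < x s := hxs ▸ mul_pos D.l_pos hsτ
      obtain ⟨v, hv, hev⟩ := hx.2 s
      have hray := D.ray_lt hτ (by linarith : τ < s) (by linarith [hs.2])
      rw [← hxs, ← hev] at hray
      refine ⟨v - l, ?_, ?_⟩
      · have : 0 < x s * (v - l) := by
          have : l ^ 2 * (s - τ) = x s * l := by rw [hxs]; ring
          linarith
        exact pos_of_mul_pos_right this hpos.le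
      · simpa using (hv hpos.ne').fun_sub (((hasDerivAt_id s).sub_const τ).const_mul l))
  have h2 : 0 < l * (e - τ) := mul_pos D.l_pos (by linarith)
  linarith

theorem neg_of_pos (D : PeriodicData T μ β c l A B C) (hx : IsSolution A B C x)
    (hp : Function.Periodic x T) (hz : HasNonconstantSign x) {t : ℝ} (ht : 0 < x t) : A t < 0 := by
  by_contra! hA
  obtain ⟨z, hz⟩ := hz
  obtain ⟨e, he, hez⟩ := hp.exists_mem_Ioc D.T_pos z t
  have := D.le_ray hx hA le_rfl he.1 he.2 (by rw [← hez, hz])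
  simp at this
  linarith

theorem pos_of_neg (D : PeriodicData T μ β c l A B C) (hx : IsSolution A B C x)
    (hp : Function.Periodic x T) (hz : HasNonconstantSign x) {t : ℝ} (ht : x t < 0) : 0 < A t := by
  obtain ⟨z, hz⟩ := hz
  have := D.reflect.neg_of_pos hx.reflect (fun t => congrArg Neg.neg (periodic_reflect hp t))
    ⟨-z, by simpa using hz⟩ (t := -t) (by simpa using ht)
  simpa using this

theorem sign_eq (D : PeriodicData T μ β c l A B C) (hx : IsSolution A B C x)
    (hp : Function.Periodic x T) (hz : HasNonconstantSign x) :
    HasSignOf x (fun t => -A t) := by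
  intro t
  rcases lt_trichotomy (x t) 0 with h | h | h
  · rw [sign_neg h, sign_neg (neg_neg_of_pos (D.pos_of_neg hx hp hz h))]
  · obtain ⟨v, -, he⟩ := hx.2 t
    have : A t = 0 := by rw [h] at he; linarith
    simp [h, this]
  · rw [sign_pos h, sign_pos (neg_pos.2 (D.neg_of_pos hx hp hz h))]

end PeriodicData

theorem HasSignOf.pos_of_neg {A x : ℝ → ℝ} (h : HasSignOf x (fun t => -A t)) {t : ℝ}
    (ht : A t < 0) : 0 < x t := by
  have := h t
  rwa [sign_pos (neg_pos.2 ht), sign_eq_one_iff] at this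

theorem HasSignOf.neg_of_pos {A x : ℝ → ℝ} (h : HasSignOf x (fun t => -A t)) {t : ℝ}
    (ht : 0 < A t) : x t < 0 := by
  have := h t
  rwa [sign_neg (neg_neg_of_pos ht), sign_eq_neg_one_iff] at this

theorem HasSignOf.zero_of_zero {A x : ℝ → ℝ} (h : HasSignOf x (fun t => -A t)) {t : ℝ}
    (ht : A t = 0) : x t = 0 := by
  have := h t
  simpa [ht] using this

theorem HasSignOf.reflect {A x : ℝ → ℝ} (h : HasSignOf x (fun t => -A t)) :
    HasSignOf (fun t => -x (-t)) (fun t => - -A (-t)) := by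
  intro t
  rw [Left.sign_neg, Left.sign_neg]
  exact congrArg _ (h (-t))

namespace PeriodicData

variable {T μ β c l : ℝ} {A B C x y : ℝ → ℝ}

theorem exists_next_zero (D : PeriodicData T μ β c l A B C) {t : ℝ} (ht : A t < 0) :
    ∃ b, t < b ∧ A b = 0 ∧ ∀ s ∈ Ico t b, A s < 0 := by
  obtain ⟨z, hz⟩ := D.zero
  obtain ⟨e, he, hez⟩ := D.perA.exists_mem_Ioc D.T_pos z t
  obtain ⟨b, h1, -, h2, h3⟩ := exists_first_zero he.1.le D.contA.continuousOn ht
    (by rw [← hez, hz])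
  exact ⟨b, h1, h2, h3⟩

/-- Where `A < 0`, two positive solutions satisfy `(x - y)' = (x - y) (-A / (x y) + C)`, so that
`(x - y)² exp (2 c t)` increases up to the next zero of `A`, where it vanishes. -/
theorem eq_of_neg (D : PeriodicData T μ β c l A B C) (hx : IsSolution A B C x)
    (hy : IsSolution A B C y) (sx : HasSignOf x (fun t => -A t))
    (sy : HasSignOf y (fun t => -A t)) {t : ℝ} (ht : A t < 0) : x t = y t := by
  obtain ⟨b, htb, hb0, hneg⟩ := D.exists_next_zero ht
  have key : MonotoneOn (fun s => (x s - y s) ^ 2 * Real.exp (2 * c * s)) (Icc t b) := by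
    refine monotoneOn_of_hasDerivWithinAt_nonneg (convex_Icc t b) (f' := fun s =>
      (2 * (x s - y s) * (deriv x s - deriv y s)) * Real.exp (2 * c * s) +
        (x s - y s) ^ 2 * (Real.exp (2 * c * s) * (2 * c))) ?_ ?_ ?_
    · have := hx.1
      have := hy.1
      fun_prop
    · intro s hs
      rw [interior_Icc] at hs
      have hAs := hneg s ⟨hs.1.le, hs.2⟩
      obtain ⟨v, hv, -⟩ := hx.2 s
      obtain ⟨w, hw, -⟩ := hy.2 s
      have hv := hv (sx.pos_of_neg hAs).ne'
      have hw := hw (sy.pos_of_neg hAs).ne'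
      rw [hv.deriv, hw.deriv]
      have h1 := (hv.fun_sub hw).fun_pow 2
      have h2 : HasDerivAt (fun s => Real.exp (2 * c * s)) (Real.exp (2 * c * s) * (2 * c)) s := by
        simpa using ((hasDerivAt_id s).const_mul (2 * c)).exp
      have h3 := (h1.fun_mul h2).hasDerivWithinAt (s := interior (Icc t b))
      simpa using h3
    · intro s hs
      rw [interior_Icc] at hs
      have hAs := hneg s ⟨hs.1.le, hs.2⟩
      obtain ⟨v, hv, hev⟩ := hx.2 s
      obtain ⟨w, hw, hew⟩ := hy.2 s
      have px := sx.pos_of_neg hAs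
      have py := sy.pos_of_neg hAs
      rw [(hv px.ne').deriv, (hw py.ne').deriv]
      have e1 : (x s - y s) * (v - w) = (x s - y s) ^ 2 * (-A s / (x s * y s) + C s) := by
        have : v = A s / x s + B s + C s * x s := by field_simp; linarith
        have : w = A s / y s + B s + C s * y s := by field_simp; linarith
        subst v w
        field_simp
        ring
      have e2 : 0 ≤ -A s / (x s * y s) := div_nonneg (by linarith) (by positivity)
      have e3 : 0 ≤ -A s / (x s * y s) + C s + c := by
        linarith [(abs_le.1 (D.abs_C_le s)).1]
      have e4 : 2 * (x s - y s) * (v - w) * Real.exp (2 * c * s) +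
          (x s - y s) ^ 2 * (Real.exp (2 * c * s) * (2 * c)) =
          2 * ((x s - y s) ^ 2 * Real.exp (2 * c * s) * (-A s / (x s * y s) + C s + c)) := by
        linear_combination 2 * Real.exp (2 * c * s) * e1
      rw [e4]
      positivity
  have h := key ⟨le_rfl, htb.le⟩ ⟨htb.le, le_rfl⟩ htb.le
  simp only [sx.zero_of_zero hb0, sy.zero_of_zero hb0, sub_self] at h
  have h2 : (x t - y t) ^ 2 ≤ 0 := by
    by_contra! h3
    have := mul_pos h3 (Real.exp_pos (2 * c * t))
    simp at h
    linarith
  have := pow_eq_zero_iff (two_ne_zero) |>.1 (le_antisymm h2 (sq_nonneg _))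
  linarith

theorem solution_unique (D : PeriodicData T μ β c l A B C) (hx : IsSolution A B C x)
    (hy : IsSolution A B C y) (sx : HasSignOf x (fun t => -A t))
    (sy : HasSignOf y (fun t => -A t)) : x = y := by
  funext t
  rcases lt_trichotomy (A t) 0 with h | h | h
  · exact D.eq_of_neg hx hy sx sy h
  · rw [sx.zero_of_zero h, sy.zero_of_zero h]
  · have := D.reflect.eq_of_neg hx.reflect hy.reflect sx.reflect sy.reflect (t := -t)
      (by simpa using h)
    simpa using this

end PeriodicData

/-! ### Solutions on a component of `{A < 0}` -/

/-- Picard–Lindelöf for a globally Lipschitz, globally bounded vector field: the terminal value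
problem is solvable on every compact interval. -/
theorem exists_terminal_solution {f : ℝ → ℝ → ℝ} {K L : NNReal}
    (hlip : ∀ t, LipschitzWith K (f t)) (hcont : ∀ x, Continuous fun t => f t x)
    (hbd : ∀ t x, |f t x| ≤ L) {a b : ℝ} (hab : a ≤ b) :
    ∃ y : ℝ → ℝ, y b = 0 ∧ ∀ t ∈ Icc a b, HasDerivWithinAt y (f t (y t)) (Icc a b) t := by
  have h : IsPicardLindelof f (⟨b, hab, le_rfl⟩ : Icc a b) (0 : ℝ)
      (L * (b - a).toNNReal) 0 L K := by
    refine ⟨fun t _ => (hlip t).lipschitzOnWith, fun x _ => (hcont x).continuousOn,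
      fun t _ x _ => hbd t x, ?_⟩
    have : (((b - a).toNNReal : NNReal) : ℝ) = b - a := Real.coe_toNNReal _ (by linarith)
    simp [this, hab]
  exact h.exists_eq_forall_mem_Icc_hasDerivWithinAt₀

/-- A pointwise limit of functions whose derivatives are uniformly bounded and converge
pointwise to `f t (y t)` is a solution of `ẏ = f(t, y)`. -/
theorem hasDerivAt_of_pointwise_limit {f : ℝ → ℝ → ℝ} (hf : Continuous (Function.uncurry f))
    {a b L : ℝ} {y : ℝ → ℝ} {Y g : ℕ → ℝ → ℝ}
    (hY : ∀ n, ∀ t ∈ Icc a b, HasDerivWithinAt (Y n) (g n t) (Icc a b) t)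
    (hg : ∀ n, ContinuousOn (g n) (Icc a b)) (hL : ∀ n, ∀ t ∈ Icc a b, |g n t| ≤ L)
    (hlim : ∀ t ∈ Icc a b, Tendsto (fun n => Y n t) atTop (𝓝 (y t)))
    (hglim : ∀ t ∈ Icc a b, Tendsto (fun n => g n t) atTop (𝓝 (f t (y t)))) :
    (∀ s ∈ Icc a b, ∀ t ∈ Icc a b, |y t - y s| ≤ L * |t - s|) ∧
      ∀ t ∈ Ioo a b, HasDerivAt y (f t (y t)) t := by
  have hlip : ∀ s ∈ Icc a b, ∀ t ∈ Icc a b, |y t - y s| ≤ L * |t - s| := by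
    intro s hs t ht
    refine le_of_tendsto ((hlim t ht).sub (hlim s hs)).abs (Eventually.of_forall fun n => ?_)
    exact (convex_Icc a b).norm_image_sub_le_of_norm_hasDerivWithin_le (hY n) (hL n) hs ht
  refine ⟨hlip, fun t₀ ht₀ => ?_⟩
  have hyc : ContinuousOn y (Icc a b) := by
    have : LipschitzOnWith L.toNNReal y (Icc a b) := by
      refine LipschitzOnWith.of_dist_le_mul fun s hs t ht => ?_
      rw [Real.dist_eq, Real.dist_eq]
      exact (hlip t ht s hs).trans (mul_le_mul_of_nonneg_right (Real.le_coe_toNNReal L)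
        (abs_nonneg _))
    exact this.continuousOn
  have hfc : ContinuousOn (fun t => f t (y t)) (Icc a b) :=
    hf.comp_continuousOn (continuousOn_id.prodMk hyc)
  have hab : a < b := ht₀.1.trans ht₀.2
  have hint : ∀ t ∈ Icc a b, y t = y a + ∫ s in a..t, f s (y s) := by
    intro t ht
    have hsub : Icc a t ⊆ Icc a b := Icc_subset_Icc_right ht.2
    have hn : ∀ n, ∫ s in a..t, g n s = Y n t - Y n a := fun n =>
      intervalIntegral.integral_eq_sub_of_hasDerivAt_of_le ht.1
        (fun s hs => ((hY n s (hsub hs)).continuousWithinAt).mono hsub)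
        (fun s hs => (hY n s (hsub (Ioo_subset_Icc_self hs))).hasDerivAt
          (Icc_mem_nhds hs.1 (hs.2.trans_le ht.2)))
        (((hg n).mono hsub).intervalIntegrable_of_Icc ht.1)
    have h1 : Tendsto (fun n => ∫ s in a..t, g n s) atTop (𝓝 (∫ s in a..t, f s (y s))) := by
      refine intervalIntegral.tendsto_integral_filter_of_dominated_convergence (fun _ => L)
        (Eventually.of_forall fun n => ?_) (Eventually.of_forall fun n => ?_)
        intervalIntegrable_const ?_
      · rw [uIoc_of_le ht.1]
        exact (((hg n).mono hsub).mono Ioc_subset_Icc_self).aestronglyMeasurable measurableSet_Ioc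
      · refine Eventually.of_forall fun s hs => ?_
        rw [uIoc_of_le ht.1] at hs
        exact hL n s (hsub (Ioc_subset_Icc_self hs))
      · refine Eventually.of_forall fun s hs => ?_
        rw [uIoc_of_le ht.1] at hs
        exact hglim s (hsub (Ioc_subset_Icc_self hs))
    simp only [hn] at h1
    have h2 := tendsto_nhds_unique h1 ((hlim t ht).sub (hlim a ⟨le_rfl, hab.le⟩))
    linarith
  have hd := intervalIntegral.integral_hasDerivAt_right
    ((hfc.mono (Icc_subset_Icc_right ht₀.2.le)).intervalIntegrable_of_Icc ht₀.1.le)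
    ((hfc.mono Ioo_subset_Icc_self).stronglyMeasurableAtFilter isOpen_Ioo t₀ ht₀)
    (hfc.continuousAt (Icc_mem_nhds ht₀.1 ht₀.2))
  refine (hd.const_add (y a)).congr_of_eventuallyEq ?_
  filter_upwards [Icc_mem_nhds ht₀.1 ht₀.2] with t ht using hint t ht

/-- The truncation of a real number to `[0, Y]`. -/
def truncate (Y y : ℝ) : ℝ := max 0 (min y Y)

theorem truncate_nonneg (Y y : ℝ) : 0 ≤ truncate Y y := le_max_left _ _

theorem truncate_le {Y : ℝ} (hY : 0 ≤ Y) (y : ℝ) : truncate Y y ≤ Y :=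
  max_le hY (min_le_right _ _)

theorem truncate_mono (Y : ℝ) : Monotone (truncate Y) := fun _ _ h =>
  max_le_max le_rfl (min_le_min h le_rfl)

theorem truncate_of_mem {Y y : ℝ} (h0 : 0 ≤ y) (hY : y ≤ Y) : truncate Y y = y := by
  rw [truncate, min_eq_left hY, max_eq_right h0]

theorem truncate_of_nonpos {Y y : ℝ} (h0 : y ≤ 0) : truncate Y y = 0 :=
  max_eq_left ((min_le_left _ _).trans h0)

theorem continuous_truncate (Y : ℝ) : Continuous (truncate Y) := by
  unfold truncate
  fun_prop

theorem abs_truncate_sub_le (Y u v : ℝ) : |truncate Y u - truncate Y v| ≤ |u - v| := by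
  refine (abs_max_sub_max_le_max _ _ _ _).trans ?_
  rw [sub_self, abs_zero]
  refine max_le (abs_nonneg _) ((abs_min_sub_min_le_max _ _ _ _).trans ?_)
  simp

/-- In terms of `y = x² / 2` a positive solution of `x ẋ = A + B x + C x²` satisfies
`ẏ = A + B √(2 y) + 2 C y`. This is the right-hand side, with `y` truncated to `[0, Y]` and, for
`δ > 0`, the square root smoothed to a Lipschitz function. -/
noncomputable def energyField (A B C : ℝ → ℝ) (Y δ t y : ℝ) : ℝ :=
  A t + B t * √(2 * truncate Y y + δ) + 2 * C t * truncate Y y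

theorem continuous_energyField {A B C : ℝ → ℝ} (hA : Continuous A) (hB : Continuous B)
    (hC : Continuous C) (Y : ℝ) :
    Continuous fun p : ℝ × ℝ × ℝ => energyField A B C Y p.1 p.2.1 p.2.2 := by
  have := continuous_truncate Y
  unfold energyField
  fun_prop

theorem abs_sqrt_sub_sqrt_le {δ p q : ℝ} (hδ : 0 < δ) (hp : 0 ≤ p) (hq : 0 ≤ q) :
    |√(p + δ) - √(q + δ)| ≤ |p - q| / √δ := by
  have h0 : 0 < √δ := Real.sqrt_pos.2 hδ
  have h1 : √δ ≤ √(p + δ) := Real.sqrt_le_sqrt (by linarith)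
  have h2 : 0 ≤ √(q + δ) := Real.sqrt_nonneg _
  rw [le_div_iff₀ h0]
  have h3 : (√(p + δ) - √(q + δ)) * (√(p + δ) + √(q + δ)) = p - q := by
    have e1 := Real.mul_self_sqrt (by linarith : 0 ≤ p + δ)
    have e2 := Real.mul_self_sqrt (by linarith : 0 ≤ q + δ)
    linear_combination e1 - e2
  rw [← h3, abs_mul]
  refine mul_le_mul_of_nonneg_left ?_ (abs_nonneg _)
  rw [abs_of_nonneg (by linarith)]
  linarith

theorem energyField_lipschitz {A B C : ℝ → ℝ} {M c Y δ : ℝ} (hδ : 0 < δ)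
    (hB : ∀ t, |B t| ≤ M) (hC : ∀ t, |C t| ≤ c) (t : ℝ) :
    LipschitzWith (M * 2 / √δ + 2 * c).toNNReal (energyField A B C Y δ t) := by
  refine LipschitzWith.of_dist_le_mul fun u v => ?_
  rw [Real.dist_eq, Real.dist_eq]
  refine le_trans ?_ (mul_le_mul_of_nonneg_right (Real.le_coe_toNNReal _) (abs_nonneg _))
  have h1 := abs_truncate_sub_le Y u v
  have h2 := abs_sqrt_sub_sqrt_le hδ (mul_nonneg zero_le_two (truncate_nonneg Y u))
    (mul_nonneg zero_le_two (truncate_nonneg Y v))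
  have h0 : 0 < √δ := Real.sqrt_pos.2 hδ
  have h3 : |√(2 * truncate Y u + δ) - √(2 * truncate Y v + δ)| ≤ 2 * |u - v| / √δ := by
    refine h2.trans (div_le_div_of_nonneg_right ?_ h0.le)
    rw [← mul_sub, abs_mul, abs_two]
    linarith
  have e : energyField A B C Y δ t u - energyField A B C Y δ t v =
      B t * (√(2 * truncate Y u + δ) - √(2 * truncate Y v + δ)) +
        2 * (C t * (truncate Y u - truncate Y v)) := by
    unfold energyField
    ring
  have h4 := mul_le_mul (hB t) h3 (abs_nonneg _) ((abs_nonneg _).trans (hB t))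
  have h5 := mul_le_mul (hC t) h1 (abs_nonneg _) ((abs_nonneg _).trans (hC t))
  rw [← abs_mul] at h4 h5
  rw [e]
  refine (abs_add_le _ _).trans ?_
  rw [abs_mul 2, abs_two]
  calc _ ≤ M * (2 * |u - v| / √δ) + 2 * (c * |u - v|) := by linarith
    _ = _ := by ring

theorem abs_energyField_le {A B C : ℝ → ℝ} {M c Y δ : ℝ} (hY : 0 ≤ Y) (hδ1 : δ ≤ 1)
    (hA : ∀ t, |A t| ≤ M) (hB : ∀ t, |B t| ≤ M) (hC : ∀ t, |C t| ≤ c) (t y : ℝ) :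
    |energyField A B C Y δ t y| ≤ M + M * √(2 * Y + 1) + 2 * (c * Y) := by
  have h0 := truncate_nonneg Y y
  have h1 := truncate_le hY y
  have h2 : √(2 * truncate Y y + δ) ≤ √(2 * Y + 1) := Real.sqrt_le_sqrt (by linarith)
  have h4 := mul_le_mul (hB t) h2 (Real.sqrt_nonneg _) ((abs_nonneg _).trans (hB t))
  have h5 := mul_le_mul (hC t) h1 h0 ((abs_nonneg _).trans (hC t))
  rw [energyField]
  refine (abs_add_three _ _ _).trans ?_
  rw [abs_mul, abs_mul, abs_mul 2, abs_two, abs_of_nonneg (Real.sqrt_nonneg _), abs_of_nonneg h0]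
  linarith [hA t]

namespace PeriodicData

variable {T μ β c l : ℝ} {A B C : ℝ → ℝ}

theorem B_pos (D : PeriodicData T μ β c l A B C) (t : ℝ) : 0 < B t := D.β_pos.trans_le (D.le_B t)

theorem exists_bound (D : PeriodicData T μ β c l A B C) :
    ∃ M, (∀ t, |A t| ≤ M) ∧ (∀ t, |B t| ≤ M) := by
  obtain ⟨M, hM⟩ := (D.perA.isBounded_of_continuous D.T_pos.ne' D.contA).exists_norm_le
  obtain ⟨N, hN⟩ := (D.perB.isBounded_of_continuous D.T_pos.ne' D.contB).exists_norm_le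
  exact ⟨max M N, fun t => (hM _ ⟨t, rfl⟩).trans (le_max_left _ _),
    fun t => (hN _ ⟨t, rfl⟩).trans (le_max_right _ _)⟩

/-- Solutions of the smoothed terminal value problem decrease with the smoothing parameter: the field is
increasing in `δ`, and one-sided Lipschitz in `y` because `B ≥ 0`. -/
theorem energy_antitone (D : PeriodicData T μ β c l A B C) {Y δ ε a b : ℝ} (hδε : δ ≤ ε)
    {y z : ℝ → ℝ} (hyb : y b = 0) (hzb : z b = 0)
    (hy : ∀ t ∈ Icc a b, HasDerivWithinAt y (energyField A B C Y δ t (y t)) (Icc a b) t)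
    (hz : ∀ t ∈ Icc a b, HasDerivWithinAt z (energyField A B C Y ε t (z t)) (Icc a b) t)
    {t : ℝ} (ht : t ∈ Icc a b) : z t ≤ y t := by
  by_contra! hlt
  have hsub : Icc t b ⊆ Icc a b := Icc_subset_Icc_left ht.1
  have := pos_of_deriv_pos_of_pos (g := fun s => (z s - y s) * Real.exp ((2 * c + 1) * s)) ht.2
    (ContinuousOn.mul (ContinuousOn.sub
      (fun s hs => (hz s (hsub hs)).continuousWithinAt.mono hsub)
      (fun s hs => (hy s (hsub hs)).continuousWithinAt.mono hsub)) (by fun_prop))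
    (mul_pos (sub_pos.2 hlt) (Real.exp_pos _)) (by
      intro s hs hpos
      have hws : 0 < z s - y s := pos_of_mul_pos_left hpos (Real.exp_pos _).le
      have hs' : s ∈ Icc a b := hsub (Ioo_subset_Icc_self hs)
      have hnh : Icc a b ∈ 𝓝 s := Icc_mem_nhds (ht.1.trans_lt hs.1) hs.2
      have h1 := ((hz s hs').hasDerivAt hnh).fun_sub ((hy s hs').hasDerivAt hnh)
      have h2 : HasDerivAt (fun s => Real.exp ((2 * c + 1) * s))
          (Real.exp ((2 * c + 1) * s) * (2 * c + 1)) s := by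
        simpa using ((hasDerivAt_id s).const_mul (2 * c + 1)).exp
      refine ⟨_, ?_, h1.fun_mul h2⟩
      have hm := truncate_mono Y (sub_pos.1 hws).le
      have h3 : √(2 * truncate Y (y s) + δ) ≤ √(2 * truncate Y (z s) + ε) :=
        Real.sqrt_le_sqrt (by linarith)
      have h4 := mul_le_mul_of_nonneg_left h3 (D.B_pos s).le
      have h5 : truncate Y (z s) - truncate Y (y s) ≤ z s - y s := by
        have := abs_truncate_sub_le Y (z s) (y s)
        rwa [abs_of_nonneg (sub_nonneg.2 hm), abs_of_pos hws] at this
      have h6 : -(c * (z s - y s)) ≤ C s * (truncate Y (z s) - truncate Y (y s)) := by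
        have i1 := mul_le_mul_of_nonneg_right (abs_le.1 (D.abs_C_le s)).1 (sub_nonneg.2 hm)
        have i2 := mul_le_mul_of_nonneg_left h5 D.c_nonneg
        linarith
      have h7 : 0 < energyField A B C Y ε s (z s) - energyField A B C Y δ s (y s) +
          (z s - y s) * (2 * c + 1) := by
        unfold energyField
        linarith
      have h8 := mul_pos h7 (Real.exp_pos ((2 * c + 1) * s))
      linarith)
  simp [hyb, hzb] at this

/-- The barrier of slope `l` in terms of `y = x² / 2`. It shows that truncation at `Y = (l T)² / 2` is
never active from above. -/
theorem energy_le_ray (D : PeriodicData T μ β c l A B C) {δ a b : ℝ} (hδ : 0 ≤ δ)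
    (ha : 0 ≤ A a) (hbT : b ≤ a + T) {y : ℝ → ℝ} (hyb : y b = 0)
    (hy : ∀ t ∈ Icc a b,
      HasDerivWithinAt y (energyField A B C (l ^ 2 * T ^ 2 / 2) δ t (y t)) (Icc a b) t)
    {t : ℝ} (ht : t ∈ Icc a b) : y t ≤ l ^ 2 * (t - a) ^ 2 / 2 := by
  by_contra! hlt
  have hsub : Icc t b ⊆ Icc a b := Icc_subset_Icc_left ht.1
  have := nonneg_of_deriv_pos_at_zeros (g := fun s => y s - l ^ 2 * (s - a) ^ 2 / 2) ht.2
    (ContinuousOn.sub (fun s hs => (hy s (hsub hs)).continuousWithinAt.mono hsub) (by fun_prop))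
    (by linarith) (by
      intro s hs h0
      have has : a < s := ht.1.trans_lt hs.1
      have hs0 : 0 < s - a := sub_pos.2 has
      have hl := D.l_pos
      have hys : y s = l ^ 2 * (s - a) ^ 2 / 2 := by linarith
      have hray := D.ray_lt ha has (hs.2.le.trans hbT)
      have htr : truncate (l ^ 2 * T ^ 2 / 2) (y s) = l ^ 2 * (s - a) ^ 2 / 2 := by
        rw [hys]
        refine truncate_of_mem (by positivity) ?_
        have : (s - a) ^ 2 ≤ T ^ 2 := pow_le_pow_left₀ hs0.le (by linarith [hs.2]) 2
        have := mul_le_mul_of_nonneg_left this (sq_nonneg l)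
        linarith
      have hsq : l * (s - a) ≤ √(2 * (l ^ 2 * (s - a) ^ 2 / 2) + δ) := by
        refine Real.le_sqrt_of_sq_le ?_
        linarith
      have hB := mul_le_mul_of_nonneg_left hsq (D.B_pos s).le
      refine ⟨energyField A B C (l ^ 2 * T ^ 2 / 2) δ s (y s) - l ^ 2 * (s - a), ?_, ?_⟩
      · rw [energyField, htr]
        linarith
      · refine ((hy s (hsub (Ioo_subset_Icc_self hs))).hasDerivAt
          (Icc_mem_nhds has hs.2)).fun_sub ?_
        have := ((((hasDerivAt_id s).sub_const a).fun_pow 2).const_mul (l ^ 2)).div_const 2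
        refine this.congr_deriv ?_
        simp only [id]
        ring)
  have hlb : y b ≤ l ^ 2 * (b - a) ^ 2 / 2 := by rw [hyb]; positivity
  rcases ht.2.lt_or_eq with h | h
  · have hb : 0 < b - a := by linarith [ht.1]
    have := mul_pos (pow_pos D.l_pos 2) (pow_pos hb 2)
    linarith
  · rw [h] at hlt
    linarith

/-- On an interval where `A < 0`, a solution for `δ = 0` that vanishes at the right end is positive: wherever
`y ≤ 0` its derivative is `A < 0`, so it cannot return to `0`. -/
theorem energy_pos {Y a b : ℝ} (hA : ∀ t ∈ Ioo a b, A t < 0)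
    {y : ℝ → ℝ} (hyc : ContinuousOn y (Icc a b)) (hyb : y b = 0)
    (hy : ∀ t ∈ Ioo a b, HasDerivAt y (energyField A B C Y 0 t (y t)) t)
    {t : ℝ} (ht : t ∈ Ioo a b) : 0 < y t := by
  have hfield : ∀ s, y s ≤ 0 → energyField A B C Y 0 s (y s) = A s := by
    intro s hs
    simp [energyField, truncate_of_nonpos hs]
  have hnn : ∀ t ∈ Ioo a b, 0 ≤ y t := by
    intro t ht
    by_contra! hlt
    have := pos_of_deriv_pos_of_pos (g := fun s => -y s) ht.2.le
      (hyc.mono (Icc_subset_Icc_left ht.1.le)).neg (by linarith) (by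
        intro s hs hpos
        have hs' : s ∈ Ioo a b := ⟨ht.1.trans hs.1, hs.2⟩
        refine ⟨_, ?_, (hy s hs').fun_neg⟩
        rw [hfield s (by linarith)]
        linarith [hA s hs'])
    rw [hyb] at this
    linarith
  refine (hnn t ht).lt_of_ne' fun h0 => ?_
  have hmin : IsLocalMin y t := by
    filter_upwards [Ioo_mem_nhds ht.1 ht.2] with s hs
    rw [h0]
    exact hnn s hs
  have h1 := hmin.hasDerivAt_eq_zero (hy t ht)
  rw [hfield t h0.le] at h1
  exact (hA t ht).ne h1

/-- On each interval between zeros of `A` where `A < 0` there is a solution `y = x² / 2 > 0` that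
vanishes at both ends, with bounds independent of the interval. -/
theorem exists_energy_arc (D : PeriodicData T μ β c l A B C) :
    ∃ K, 0 < K ∧ ∀ a b, a < b → b ≤ a + T → A a = 0 → (∀ t ∈ Ioo a b, A t < 0) →
      ∃ y : ℝ → ℝ, ∀ t ∈ Ioo a b, 0 < y t ∧
        HasDerivAt y (A t + B t * √(2 * y t) + 2 * C t * y t) t ∧
        y t ≤ K * (t - a) ∧ y t ≤ K * (b - t) := by
  obtain ⟨M, hAM, hBM⟩ := D.exists_bound
  set Y := l ^ 2 * T ^ 2 / 2 with hYdef
  have hY : 0 ≤ Y := by positivity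
  have hM : 0 ≤ M := (abs_nonneg _).trans (hAM 0)
  have hc := D.c_nonneg
  set L := M + M * √(2 * Y + 1) + 2 * (c * Y) with hLdef
  have hL : 0 ≤ L := by positivity
  have hl := D.l_pos
  have hT := D.T_pos
  refine ⟨max L (l ^ 2 * T / 2), lt_max_of_lt_right (by positivity),
    fun a b hab hbT hAa hneg => ?_⟩
  have hδ : ∀ n : ℕ, 0 < 1 / ((n : ℝ) + 1) := fun n => by positivity
  have hδ1 : ∀ n : ℕ, 1 / ((n : ℝ) + 1) ≤ 1 := fun n => by
    rw [div_le_one (by positivity)]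
    linarith [n.cast_nonneg (α := ℝ)]
  have hcontF := continuous_energyField D.contA D.contB D.contC Y
  have hex : ∀ n : ℕ, ∃ z : ℝ → ℝ, z b = 0 ∧ ∀ t ∈ Icc a b,
      HasDerivWithinAt z (energyField A B C Y (1 / ((n : ℝ) + 1)) t (z t)) (Icc a b) t := by
    intro n
    refine exists_terminal_solution (L := ⟨L, hL⟩)
      (energyField_lipschitz (hδ n) hBM D.abs_C_le) (fun x => ?_)
      (abs_energyField_le hY (hδ1 n) hAM hBM D.abs_C_le) hab.le
    exact hcontF.comp (by fun_prop : Continuous fun t : ℝ => ((1 / ((n : ℝ) + 1), t, x) : ℝ × ℝ × ℝ))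
  choose z hzb hz using hex
  have hzc : ∀ n, ContinuousOn (z n) (Icc a b) := fun n t ht => (hz n t ht).continuousWithinAt
  have hmono : ∀ t ∈ Icc a b, Monotone fun n => z n t := fun t ht m n hmn =>
    D.energy_antitone (one_div_le_one_div_of_le (by positivity) (by gcongr)) (hzb n) (hzb m)
      (hz n) (hz m) ht
  have hray : ∀ t ∈ Icc a b, ∀ n, z n t ≤ l ^ 2 * (t - a) ^ 2 / 2 := fun t ht n =>
    D.energy_le_ray (hδ n).le hAa.ge hbT (hzb n) (hz n) ht
  have hlim : ∀ t ∈ Icc a b, Tendsto (fun n => z n t) atTop (𝓝 (⨆ n, z n t)) := fun t ht =>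
    tendsto_atTop_ciSup (hmono t ht) ⟨_, forall_mem_range.2 (hray t ht)⟩
  set y : ℝ → ℝ := fun t => ⨆ n, z n t with hydef
  have hyb : y b = 0 := by simp [hydef, hzb]
  have hyray : ∀ t ∈ Icc a b, y t ≤ l ^ 2 * (t - a) ^ 2 / 2 := fun t ht => ciSup_le (hray t ht)
  have hδlim : Tendsto (fun n : ℕ => 1 / ((n : ℝ) + 1)) atTop (𝓝 0) :=
    tendsto_one_div_add_atTop_nhds_zero_nat
  obtain ⟨hlip, hyd⟩ := hasDerivAt_of_pointwise_limit (f := energyField A B C Y 0) (L := L) (y := y)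
    (g := fun n t => energyField A B C Y (1 / ((n : ℝ) + 1)) t (z n t))
    (hcontF.comp (by fun_prop : Continuous fun p : ℝ × ℝ => ((0, p.1, p.2) : ℝ × ℝ × ℝ)))
    hz (fun n => hcontF.comp_continuousOn
      (continuousOn_const.prodMk (continuousOn_id.prodMk (hzc n))))
    (fun n t _ => abs_energyField_le hY (hδ1 n) hAM hBM D.abs_C_le t _) hlim
    (fun t ht => (hcontF.tendsto (0, t, y t)).comp
      (hδlim.prodMk_nhds (tendsto_const_nhds.prodMk_nhds (hlim t ht))))
  have hyc : ContinuousOn y (Icc a b) := by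
    have : LipschitzOnWith L.toNNReal y (Icc a b) := by
      refine LipschitzOnWith.of_dist_le_mul fun s hs t ht => ?_
      rw [Real.dist_eq, Real.dist_eq, Real.coe_toNNReal L hL]
      exact hlip t ht s hs
    exact this.continuousOn
  refine ⟨y, fun t ht => ?_⟩
  have ht' := Ioo_subset_Icc_self ht
  have hpos := energy_pos hneg hyc hyb hyd ht
  have hta : 0 < t - a := sub_pos.2 ht.1
  have htT : t - a ≤ T := by linarith [ht.2]
  have h2 : l ^ 2 * (t - a) ^ 2 / 2 ≤ l ^ 2 * T / 2 * (t - a) := by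
    have := mul_le_mul_of_nonneg_left htT (mul_nonneg (sq_nonneg l) hta.le)
    linarith
  have hle : y t ≤ Y := by
    have := mul_le_mul_of_nonneg_left htT (by positivity : 0 ≤ l ^ 2 * T / 2)
    have := hyray t ht'
    rw [hYdef]
    linarith
  refine ⟨hpos, ?_, ?_, ?_⟩
  · have := hyd t ht
    rwa [energyField, truncate_of_mem hpos.le hle, add_zero] at this
  · exact ((hyray t ht').trans h2).trans
      (mul_le_mul_of_nonneg_right (le_max_right _ _) hta.le)
  · have h3 := hlip t ht' b ⟨hab.le, le_rfl⟩
    rw [hyb, zero_sub, abs_neg, abs_of_pos hpos, abs_of_pos (sub_pos.2 ht.2)] at h3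
    exact h3.trans (mul_le_mul_of_nonneg_right (le_max_left _ _) (sub_pos.2 ht.2).le)

end PeriodicData

/-! ### The global periodic solution -/

theorem IsSolution.shift {A B C x : ℝ → ℝ} {T : ℝ} (hA : Function.Periodic A T)
    (hB : Function.Periodic B T) (hC : Function.Periodic C T) (h : IsSolution A B C x) :
    IsSolution A B C fun t => x (t + T) := by
  refine ⟨h.1.comp (continuous_add_const T), fun t => ?_⟩
  obtain ⟨v, hv, he⟩ := h.2 (t + T)
  rw [hA, hB, hC] at he
  exact ⟨v, fun h0 => (hv h0).comp_add_const t T, he⟩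

namespace PeriodicData

variable {T μ β c l : ℝ} {A B C : ℝ → ℝ}

theorem exists_negative_component (D : PeriodicData T μ β c l A B C) {t : ℝ} (ht : A t < 0) :
    ∃ p : ℝ × ℝ, t ∈ Ioo p.1 p.2 ∧ p.2 ≤ p.1 + T ∧ A p.1 = 0 ∧ A p.2 = 0 ∧
      ∀ s ∈ Ioo p.1 p.2, A s < 0 := by
  obtain ⟨b, htb, hb0, hb⟩ := D.exists_next_zero ht
  have hab : A (b - T) = 0 := by rw [← hb0, ← D.perA (b - T), sub_add_cancel]
  have hbt : b - T ≤ t := by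
    by_contra! h
    have := hb (b - T) ⟨h.le, by linarith [D.T_pos]⟩
    linarith
  obtain ⟨a, h1, h2, h3, h4⟩ := exists_last_zero hbt D.contA.continuousOn ht hab.ge
  refine ⟨(a, b), ⟨h2, htb⟩, by simpa using by linarith, h3, hb0, fun s hs => ?_⟩
  rcases le_total s t with h | h
  · exact h4 s ⟨hs.1, h⟩
  · exact hb s ⟨h, hs.2⟩

/-- The positive half of the solution: zero where `A ≥ 0`, and glued from the arcs of
`exists_energy_arc` on the components of `{A < 0}`. -/
theorem exists_positive_part (D : PeriodicData T μ β c l A B C) :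
    ∃ X : ℝ → ℝ, Continuous X ∧ (∀ t, 0 ≤ A t → X t = 0) ∧ ∀ t, A t < 0 →
      0 < X t ∧ ∃ v, HasDerivAt X v t ∧ X t * v = A t + B t * X t + C t * X t ^ 2 := by
  obtain ⟨K, hK, harc⟩ := D.exists_energy_arc
  have hcomp : ∀ t, ∃ p : ℝ × ℝ, A t < 0 → t ∈ Ioo p.1 p.2 ∧ p.2 ≤ p.1 + T ∧ A p.1 = 0 ∧
      A p.2 = 0 ∧ ∀ s ∈ Ioo p.1 p.2, A s < 0 := by
    intro t
    by_cases ht : A t < 0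
    · obtain ⟨p, hp⟩ := D.exists_negative_component ht
      exact ⟨p, fun _ => hp⟩
    · exact ⟨0, fun h => absurd h ht⟩
  choose p hp using hcomp
  -- `p` is constant on each component of `{A < 0}`, so a single arc is used near each point
  have hpeq : ∀ t, A t < 0 → ∀ s ∈ Ioo (p t).1 (p t).2, p s = p t := by
    intro t ht s hs
    obtain ⟨-, -, ha, hb, hneg⟩ := hp t ht
    obtain ⟨hs', -, ha', hb', hneg'⟩ := hp s (hneg s hs)
    have e1 : ¬((p t).1 < (p s).1) := fun h => (hneg _ ⟨h, hs'.1.trans hs.2⟩).ne ha'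
    have e2 : ¬((p s).1 < (p t).1) := fun h => (hneg' _ ⟨h, hs.1.trans hs'.2⟩).ne ha
    have e3 : ¬((p t).2 < (p s).2) := fun h => (hneg' _ ⟨hs'.1.trans hs.2, h⟩).ne hb
    have e4 : ¬((p s).2 < (p t).2) := fun h => (hneg _ ⟨hs.1.trans hs'.2, h⟩).ne hb'
    exact Prod.ext (le_antisymm (not_lt.1 e1) (not_lt.1 e2))
      (le_antisymm (not_lt.1 e3) (not_lt.1 e4))
  have harc' : ∀ q : ℝ × ℝ, ∃ y : ℝ → ℝ, q.1 < q.2 → q.2 ≤ q.1 + T → A q.1 = 0 →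
      (∀ t ∈ Ioo q.1 q.2, A t < 0) → ∀ t ∈ Ioo q.1 q.2, 0 < y t ∧
        HasDerivAt y (A t + B t * √(2 * y t) + 2 * C t * y t) t ∧
        y t ≤ K * (t - q.1) ∧ y t ≤ K * (q.2 - t) := by
    intro q
    by_cases h : q.1 < q.2 ∧ q.2 ≤ q.1 + T ∧ A q.1 = 0 ∧ ∀ t ∈ Ioo q.1 q.2, A t < 0
    · obtain ⟨y, hy⟩ := harc q.1 q.2 h.1 h.2.1 h.2.2.1 h.2.2.2
      exact ⟨y, fun _ _ _ _ => hy⟩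
    · exact ⟨0, fun h1 h2 h3 h4 => absurd ⟨h1, h2, h3, h4⟩ h⟩
  choose y hy using harc'
  have hyp : ∀ t, A t < 0 → ∀ s ∈ Ioo (p t).1 (p t).2, 0 < y (p t) s ∧
        HasDerivAt (y (p t)) (A s + B s * √(2 * y (p t) s) + 2 * C s * y (p t) s) s ∧
        y (p t) s ≤ K * (s - (p t).1) ∧ y (p t) s ≤ K * ((p t).2 - s) := by
    intro t ht
    obtain ⟨h1, h2, h3, -, h5⟩ := hp t ht
    exact hy (p t) (h1.1.trans h1.2) h2 h3 h5
  set X : ℝ → ℝ := fun t => if A t < 0 then √(2 * y (p t) t) else 0 with hX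
  have hXneg : ∀ t, A t < 0 → X t = √(2 * y (p t) t) := fun t ht => if_pos ht
  have hXzero : ∀ t, 0 ≤ A t → X t = 0 := fun t ht => if_neg (not_lt.2 ht)
  have hXnn : ∀ t, 0 ≤ X t := by
    intro t
    rcases lt_or_ge (A t) 0 with h | h
    · rw [hXneg t h]
      exact Real.sqrt_nonneg _
    · rw [hXzero t h]
  have hXd : ∀ t, A t < 0 →
      0 < X t ∧ ∃ v, HasDerivAt X v t ∧ X t * v = A t + B t * X t + C t * X t ^ 2 := by
    intro t ht
    obtain ⟨htp, -, -, -, hneg⟩ := hp t ht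
    obtain ⟨hpos, hd, -⟩ := hyp t ht t htp
    have hXpos : 0 < X t := by
      rw [hXneg t ht]
      exact Real.sqrt_pos.2 (by linarith)
    have hev : X =ᶠ[𝓝 t] fun s => √(2 * y (p t) s) := by
      filter_upwards [Ioo_mem_nhds htp.1 htp.2] with s hs
      rw [hXneg s (hneg s hs), hpeq t ht s hs]
    refine ⟨hXpos, _, ((hd.const_mul 2).sqrt (by linarith)).congr_of_eventuallyEq hev, ?_⟩
    have hsq : X t ^ 2 = 2 * y (p t) t := by
      rw [hXneg t ht]
      exact Real.sq_sqrt (by linarith)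
    rw [← hXneg t ht]
    field_simp
    rw [hsq]
    ring
  -- the uniform bounds on the arcs give continuity even where components accumulate
  have hbound : ∀ t₁, 0 ≤ A t₁ → ∀ t, X t ≤ √(2 * (K * |t - t₁|)) := by
    intro t₁ ht₁ t
    rcases lt_or_ge (A t) 0 with h | h
    · obtain ⟨htp, -, -, -, hneg⟩ := hp t h
      obtain ⟨-, -, hl, hr⟩ := hyp t h t htp
      rw [hXneg t h]
      refine Real.sqrt_le_sqrt (mul_le_mul_of_nonneg_left ?_ zero_le_two)
      rcases le_or_gt t₁ (p t).1 with h1 | h1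
      · refine hl.trans (mul_le_mul_of_nonneg_left ?_ hK.le)
        exact (by linarith : t - (p t).1 ≤ t - t₁).trans (le_abs_self _)
      · have h2 : (p t).2 ≤ t₁ := by
          by_contra! h2
          exact absurd ht₁ (not_le.2 (hneg t₁ ⟨h1, h2⟩))
        refine hr.trans (mul_le_mul_of_nonneg_left ?_ hK.le)
        exact (by linarith : (p t).2 - t ≤ -(t - t₁)).trans (neg_le_abs _)
    · rw [hXzero t h]
      exact Real.sqrt_nonneg _
  refine ⟨X, continuous_iff_continuousAt.2 fun t₁ => ?_, hXzero, hXd⟩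
  rcases lt_or_ge (A t₁) 0 with h | h
  · obtain ⟨-, v, hv, -⟩ := hXd t₁ h
    exact hv.continuousAt
  · rw [ContinuousAt, hXzero t₁ h]
    refine squeeze_zero hXnn (hbound t₁ h) ?_
    have : Continuous fun t => √(2 * (K * |t - t₁|)) := by fun_prop
    simpa using this.tendsto t₁

theorem exists_solution (D : PeriodicData T μ β c l A B C) :
    ∃ x : ℝ → ℝ, IsSolution A B C x ∧ Function.Periodic x T ∧ HasSignOf x (fun t => -A t) := by
  obtain ⟨X, hXc, hX0, hX⟩ := D.exists_positive_part
  obtain ⟨Z, hZc, hZ0, hZ⟩ := D.reflect.exists_positive_part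
  have hZ0' : ∀ t, A t ≤ 0 → Z (-t) = 0 := fun t ht => hZ0 (-t) (by simpa using ht)
  have hsol : IsSolution A B C fun t => X t - Z (-t) := by
    refine ⟨hXc.sub (hZc.comp continuous_neg), fun t => ?_⟩
    rcases lt_trichotomy (A t) 0 with h | h | h
    · obtain ⟨-, v, hv, he⟩ := hX t h
      refine ⟨v, fun _ => hv.congr_of_eventuallyEq ?_, ?_⟩
      · filter_upwards [D.contA.continuousAt.eventually_lt continuousAt_const h] with s hs
        rw [hZ0' s hs.le, sub_zero]
      · simp only [hZ0' t h.le, sub_zero, he]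
    · refine ⟨0, fun h0 => absurd ?_ h0, ?_⟩ <;> simp [hX0 t h.ge, hZ0' t h.le, h]
    · obtain ⟨-, v, hv, he⟩ := hZ (-t) (by simpa using h)
      refine ⟨v, fun _ => ?_, ?_⟩
      · have h1 := (hv.scomp t (hasDerivAt_neg t)).fun_neg
        have h2 : HasDerivAt (fun s => -Z (-s)) v t := by
          simpa [Function.comp_def] using h1
        refine h2.congr_of_eventuallyEq ?_
        filter_upwards [continuousAt_const.eventually_lt D.contA.continuousAt h] with s hs
        rw [hX0 s hs.le, zero_sub]
      · simp only [hX0 t h.le, zero_sub]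
        simp only [neg_neg] at he
        linear_combination -he
  have hsign : HasSignOf (fun t => X t - Z (-t)) (fun t => -A t) := by
    intro t
    rcases lt_trichotomy (A t) 0 with h | h | h
    · simp only [hZ0' t h.le, sub_zero]
      rw [sign_pos (hX t h).1, sign_pos (neg_pos.2 h)]
    · simp [hX0 t h.ge, hZ0' t h.le, h]
    · simp only [hX0 t h.le, zero_sub]
      rw [sign_neg (neg_neg_of_pos (hZ (-t) (by simpa using h)).1),
        sign_neg (neg_neg_of_pos h)]
  -- the shifted solution has the same sign, so periodicity follows from uniqueness
  refine ⟨_, hsol, fun t => ?_, hsign⟩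
  refine congrFun (D.solution_unique (hsol.shift D.perA D.perB D.perC) hsol (fun t => ?_) hsign) t
  rw [hsign (t + T)]
  simp only [D.perA t]

end PeriodicData

/-! ### Smoothness at simple zeros of `A` -/

/-- Bounded solutions of `(t - τ) v̇ = α / v + b - v` converge as `t ↓ τ` when `α` and `b` do: a
level `r` with `p / r + q - r ≠ 0` is eventually crossed in one direction only. -/
theorem tendsto_of_singular_ode {v α b : ℝ → ℝ} {τ p q V : ℝ}
    (hα : Tendsto α (𝓝[>] τ) (𝓝 p)) (hb : Tendsto b (𝓝[>] τ) (𝓝 q))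
    (hv : ∀ᶠ t in 𝓝[>] τ, HasDerivAt v ((α t / v t + b t - v t) / (t - τ)) t)
    (hV : ∀ᶠ t in 𝓝[>] τ, |v t| ≤ V) :
    ∃ m, Tendsto v (𝓝[>] τ) (𝓝 m) := by
  refine tendsto_of_no_upcrossings dense_univ ?_
    (isBoundedUnder_of_eventually_le (a := V) (hV.mono fun t h => (abs_le.1 h).2))
    (isBoundedUnder_of_eventually_ge (a := -V) (hV.mono fun t h => (abs_le.1 h).1))
  rintro a - d - had ⟨hfa, hfd⟩
  have hfin : ({0, q / 2 + √((q / 2) ^ 2 + p), q / 2 - √((q / 2) ^ 2 + p)} : Set ℝ).Finite :=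
    toFinite _
  -- `p / r + q - r = 0` holds at most for two nonzero `r`
  obtain ⟨r, hr, hrn⟩ := (Ioo_infinite had).exists_notMem_finite hfin
  simp only [mem_insert_iff, mem_singleton_iff, not_or] at hrn
  obtain ⟨hr0, hr1, hr2⟩ := hrn
  have hψ : p / r + q - r ≠ 0 := by
    intro h
    have h1 : (r - q / 2) ^ 2 = (q / 2) ^ 2 + p := by
      field_simp at h
      linear_combination -h
    have h2 := Real.sqrt_sq_eq_abs (r - q / 2)
    rw [h1] at h2
    rcases abs_choice (r - q / 2) with h3 | h3
    · exact hr1 (by linarith)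
    · exact hr2 (by linarith)
  have hψlim : Tendsto (fun t => α t / r + b t - r) (𝓝[>] τ) (𝓝 (p / r + q - r)) :=
    ((hα.div_const r).add hb).sub_const r
  have hIoo : ∀ {P : ℝ → Prop} {u}, τ < u → (∃ᶠ t in 𝓝[>] τ, P t) → ∃ t ∈ Ioo τ u, P t :=
    fun hu hP => (hP.and_eventually (Ioo_mem_nhdsGT hu)).exists.imp fun _ h => ⟨h.2, h.1⟩
  rcases hψ.lt_or_gt with hneg | hpos
  · obtain ⟨u, hu, hsub⟩ := mem_nhdsGT_iff_exists_Ioo_subset.1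
      (hv.and (hψlim.eventually_lt_const hneg))
    obtain ⟨t₂, ht₂, h2⟩ := hIoo hu hfd
    obtain ⟨t₁, ht₁, h1⟩ := hIoo ht₂.1 hfa
    have hmem : ∀ t ∈ Icc t₁ t₂, t ∈ Ioo τ u := fun t ht =>
      ⟨ht₁.1.trans_le ht.1, ht.2.trans_lt ht₂.2⟩
    have := nonneg_of_deriv_pos_at_zeros (g := fun t => r - v t) ht₁.2.le
      (fun t ht => ((hsub (hmem t ht)).1.continuousAt.continuousWithinAt).const_sub r)
      (by linarith [hr.1]) (by
        intro t ht h0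
        have hvr : v t = r := by linarith
        obtain ⟨hd, hs⟩ := hsub (hmem t (Ioo_subset_Icc_self ht))
        rw [hvr] at hd
        refine ⟨_, ?_, hd.const_sub r⟩
        have h3 : τ < t := (hmem t (Ioo_subset_Icc_self ht)).1
        exact neg_pos.2 (div_neg_of_neg_of_pos hs (sub_pos.2 h3)))
    linarith [hr.2]
  · obtain ⟨u, hu, hsub⟩ := mem_nhdsGT_iff_exists_Ioo_subset.1
      (hv.and (hψlim.eventually_const_lt hpos))
    obtain ⟨t₂, ht₂, h2⟩ := hIoo hu hfa
    obtain ⟨t₁, ht₁, h1⟩ := hIoo ht₂.1 hfd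
    have hmem : ∀ t ∈ Icc t₁ t₂, t ∈ Ioo τ u := fun t ht =>
      ⟨ht₁.1.trans_le ht.1, ht.2.trans_lt ht₂.2⟩
    have := nonneg_of_deriv_pos_at_zeros (g := fun t => v t - r) ht₁.2.le
      (fun t ht => ((hsub (hmem t ht)).1.continuousAt.continuousWithinAt).sub_const r)
      (by linarith [hr.2]) (by
        intro t ht h0
        have hvr : v t = r := by linarith
        obtain ⟨hd, hs⟩ := hsub (hmem t (Ioo_subset_Icc_self ht))
        rw [hvr] at hd
        refine ⟨_, ?_, hd.sub_const r⟩
        have h3 : τ < t := (hmem t (Ioo_subset_Icc_self ht)).1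
        exact div_pos hs (sub_pos.2 h3))
    linarith [hr.1]

theorem HasSignOf.ne_zero {A x : ℝ → ℝ} (h : HasSignOf x (fun t => -A t)) {t : ℝ}
    (ht : A t ≠ 0) : x t ≠ 0 := by
  rcases ht.lt_or_gt with h0 | h0
  · exact (h.pos_of_neg h0).ne'
  · exact (h.neg_of_pos h0).ne

theorem IsSolution.hasDerivAt {A B C x : ℝ → ℝ} (h : IsSolution A B C x) {t : ℝ} (ht : x t ≠ 0) :
    HasDerivAt x (A t / x t + B t + C t * x t) t := by
  obtain ⟨v, hv, he⟩ := h.2 t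
  refine (hv ht).congr_deriv ?_
  field_simp
  linarith

theorem periodic_deriv {f : ℝ → ℝ} {T : ℝ} (h : Function.Periodic f T) :
    Function.Periodic (deriv f) T := fun t => by
  rw [← deriv_comp_add_const]
  exact congrArg (deriv · t) (funext h)

namespace PeriodicData

variable {T μ β c l : ℝ} {A B C x : ℝ → ℝ}

/-- Where `A < 0`, the function `-κ A` is a lower barrier for `x` backwards in time from
the next zero of `A`, if `κ` is small. -/
theorem mul_neg_le (D : PeriodicData T μ β c l A B C) (hx : IsSolution A B C x)
    (sx : HasSignOf x (fun t => -A t)) {κ M N P : ℝ} (hκ : 0 < κ)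
    (hκ1 : κ * (M + c * N + κ * P) < 1) (hB : ∀ t, |B t| ≤ M) (hN : ∀ t, |x t| ≤ N)
    (hP : ∀ t, |deriv A t| ≤ P) {t : ℝ} (ht : A t < 0) : κ * -A t ≤ x t := by
  by_contra! hlt
  obtain ⟨b, htb, hb0, hneg⟩ := D.exists_next_zero ht
  have := pos_of_deriv_pos_of_pos (g := fun s => κ * -A s - x s) htb.le
    (by have := D.contA; have := hx.1; fun_prop) (by linarith) (by
      intro s hs hpos
      have hAs := hneg s ⟨hs.1.le, hs.2⟩
      have hxs := sx.pos_of_neg hAs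
      have hd := hx.hasDerivAt hxs.ne'
      refine ⟨_, ?_, (((D.hasDerivAt_A s).fun_neg).const_mul κ).fun_sub hd⟩
      have h1 : κ * (A s / x s) < -1 := by
        rw [← mul_div_assoc, div_lt_iff₀ hxs]
        linarith
      have h2 : κ * B s ≤ κ * M := mul_le_mul_of_nonneg_left ((le_abs_self _).trans (hB s)) hκ.le
      have h3 : κ * (C s * x s) ≤ κ * (c * N) := by
        refine mul_le_mul_of_nonneg_left ((le_abs_self _).trans ?_) hκ.le
        rw [abs_mul]
        exact mul_le_mul (D.abs_C_le s) (hN s) (abs_nonneg _) D.c_nonneg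
      have h4 : κ * (κ * deriv A s) ≤ κ * (κ * P) :=
        mul_le_mul_of_nonneg_left
          (mul_le_mul_of_nonneg_left ((le_abs_self _).trans (hP s)) hκ.le) hκ.le
      have h5 : 0 < κ * (κ * -deriv A s - (A s / x s + B s + C s * x s)) := by linarith
      exact pos_of_mul_pos_right h5 hκ.le)
  simp [hb0, sx.zero_of_zero hb0] at this

theorem exists_mul_abs_le (D : PeriodicData T μ β c l A B C) (hx : IsSolution A B C x)
    (hp : Function.Periodic x T) (sx : HasSignOf x (fun t => -A t)) :
    ∃ κ > 0, ∀ t, κ * |A t| ≤ |x t| := by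
  obtain ⟨M, -, hM⟩ := D.exists_bound
  obtain ⟨N, hN⟩ := (hp.isBounded_of_continuous D.T_pos.ne' hx.1).exists_norm_le
  obtain ⟨P, hP⟩ := ((periodic_deriv D.perA).isBounded_of_continuous D.T_pos.ne'
    (D.contDiffA.continuous_deriv le_rfl)).exists_norm_le
  replace hN : ∀ t, |x t| ≤ N := fun t => hN _ ⟨t, rfl⟩
  replace hP : ∀ t, |deriv A t| ≤ P := fun t => hP _ ⟨t, rfl⟩
  have hM0 : 0 ≤ M := (abs_nonneg _).trans (hM 0)
  have hN0 : 0 ≤ N := (abs_nonneg _).trans (hN 0)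
  have hP0 : 0 ≤ P := (abs_nonneg _).trans (hP 0)
  have hcN : 0 ≤ c * N := mul_nonneg D.c_nonneg hN0
  set κ := 1 / (M + c * N + P + 1) with hκdef
  have hκ : 0 < κ := by positivity
  have hκle : κ ≤ 1 := by
    rw [hκdef, div_le_one (by positivity)]
    linarith
  have hκ1 : κ * (M + c * N + κ * P) < 1 := by
    have h1 : κ * (M + c * N + P + 1) = 1 := by rw [hκdef]; field_simp
    have h2 := mul_le_mul_of_nonneg_right hκle hP0
    have h3 := mul_le_mul_of_nonneg_left h2 hκ.le
    linarith
  refine ⟨κ, hκ, fun t => ?_⟩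
  rcases lt_trichotomy (A t) 0 with h | h | h
  · rw [abs_of_neg h, abs_of_pos (sx.pos_of_neg h)]
    exact D.mul_neg_le hx sx hκ hκ1 hM hN hP h
  · simp [h]
  · rw [abs_of_pos h, abs_of_neg (sx.neg_of_pos h)]
    have := D.reflect.mul_neg_le hx.reflect sx.reflect hκ hκ1 (fun t => hM _)
      (fun t => by simpa using hN (-t)) (fun t => by rw [deriv_reflect]; exact hP _) (t := -t)
      (by simpa using h)
    simpa using this

/-- At a simple zero of `A` the solution has a right derivative `m`, to which `ẋ` converges; `m` is
a root of `m² = B m + Ȧ`. At a saddle (`Ȧ > 0`) it is the negative root, at a node (`Ȧ < 0`) the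
bound `m ≤ l` identifies it as the smaller of the two positive roots. -/
theorem exists_right_deriv (D : PeriodicData T μ β c l A B C) (hx : IsSolution A B C x)
    (hp : Function.Periodic x T) (sx : HasSignOf x (fun t => -A t)) {τ : ℝ} (hτ : A τ = 0)
    (hτ' : deriv A τ ≠ 0) :
    ∃ m, Tendsto (deriv x) (𝓝[>] τ) (𝓝 m) ∧ HasDerivWithinAt x m (Ici τ) τ ∧
      m ^ 2 = B τ * m + deriv A τ ∧ (0 < deriv A τ → m < 0) ∧
      (deriv A τ < 0 → 0 < m ∧ m ≤ l) := by
  obtain ⟨κ, hκ, hκx⟩ := D.exists_mul_abs_le hx hp sx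
  obtain ⟨M, -, hM⟩ := D.exists_bound
  obtain ⟨N, hN⟩ := (hp.isBounded_of_continuous D.T_pos.ne' hx.1).exists_norm_le
  replace hN : ∀ t, |x t| ≤ N := fun t => hN _ ⟨t, rfl⟩
  have hxτ : x τ = 0 := sx.zero_of_zero hτ
  have hα : Tendsto (fun t => A t / (t - τ)) (𝓝[>] τ) (𝓝 (deriv A τ)) := by
    refine ((hasDerivAt_iff_tendsto_slope.1 (D.hasDerivAt_A τ)).mono_left
      (nhdsWithin_mono τ fun z hz => ne_of_gt hz)).congr fun t => ?_
    rw [slope_def_field, hτ, sub_zero]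
  have hA0 : ∀ᶠ t in 𝓝[>] τ, A t ≠ 0 := by
    filter_upwards [hα.eventually_ne hτ'] with t ht h0
    simp [h0] at ht
  have hderiv : ∀ t, A t ≠ 0 → deriv x t = A t / x t + B t + C t * x t := fun t ht =>
    (hx.hasDerivAt (sx.ne_zero ht)).deriv
  have hbd : ∀ t, A t ≠ 0 → |deriv x t| ≤ 1 / κ + M + c * N := by
    intro t ht
    rw [hderiv t ht]
    have h1 : |A t / x t| ≤ 1 / κ := by
      rw [abs_div, div_le_div_iff₀ (abs_pos.2 (sx.ne_zero ht)) hκ]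
      linarith [hκx t]
    have h2 : |C t * x t| ≤ c * N := by
      rw [abs_mul]
      exact mul_le_mul (D.abs_C_le t) (hN t) (abs_nonneg _) D.c_nonneg
    exact (abs_add_three _ _ _).trans (by linarith [hM t])
  obtain ⟨u, hu, hsub⟩ := mem_nhdsGT_iff_exists_Ioo_subset.1 hA0
  have hIoo : ∀ᶠ t in 𝓝[>] τ, t ∈ Ioo τ u := Ioo_mem_nhdsGT hu
  have hdiff : DifferentiableOn ℝ x (Ioo τ u) := fun t ht =>
    (hx.hasDerivAt (sx.ne_zero (hsub ht))).differentiableAt.differentiableWithinAt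
  have hV : ∀ᶠ t in 𝓝[>] τ, |x t / (t - τ)| ≤ 1 / κ + M + c * N := by
    filter_upwards [hIoo] with t ht
    obtain ⟨ξ, hξ, he⟩ := exists_deriv_eq_slope x ht.1 hx.1.continuousOn
      (hdiff.mono (Ioo_subset_Ioo_right ht.2.le))
    rw [hxτ, sub_zero] at he
    rw [← he]
    exact hbd ξ (hsub ⟨hξ.1, hξ.2.trans ht.2⟩)
  have hbC : Tendsto (fun t => B t + C t * x t) (𝓝[>] τ) (𝓝 (B τ)) := by
    have : Continuous fun t => B t + C t * x t := by
      have := D.contB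
      have := D.contC
      have := hx.1
      fun_prop
    have := this.tendsto τ
    rw [hxτ, mul_zero, add_zero] at this
    exact this.mono_left nhdsWithin_le_nhds
  have hquot : ∀ t ∈ Ioo τ u, A t / (t - τ) / (x t / (t - τ)) = A t / x t := by
    intro t ht
    exact div_div_div_cancel_right₀ (sub_pos.2 ht.1).ne' _ _
  obtain ⟨m, hm⟩ := tendsto_of_singular_ode (v := fun t => x t / (t - τ)) hα hbC (by
    filter_upwards [hIoo] with t ht
    have h0 : t - τ ≠ 0 := (sub_pos.2 ht.1).ne'
    refine ((hx.hasDerivAt (sx.ne_zero (hsub ht))).fun_div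
      ((hasDerivAt_id t).sub_const τ) h0).congr_deriv ?_
    rw [hquot t ht]
    simp only [id]
    field_simp
    ring) hV
  have hm0 : m ≠ 0 := by
    have h1 : κ * |deriv A τ| ≤ |m| := by
      refine le_of_tendsto_of_tendsto (hα.abs.const_mul κ) hm.abs ?_
      filter_upwards [hIoo] with t ht
      rw [abs_div, abs_div, ← mul_div_assoc]
      exact div_le_div_of_nonneg_right (hκx t) (abs_nonneg _)
    exact abs_pos.1 ((mul_pos hκ (abs_pos.2 hτ')).trans_le h1)
  have hlim : Tendsto (deriv x) (𝓝[>] τ) (𝓝 (deriv A τ / m + B τ)) := by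
    refine ((hα.div hm hm0).add hbC).congr' ?_
    filter_upwards [hIoo] with t ht
    rw [hderiv t (hsub ht), Pi.div_apply, hquot t ht]
    ring
  have hright : HasDerivWithinAt x (deriv A τ / m + B τ) (Ici τ) τ :=
    hasDerivWithinAt_Ici_of_tendsto_deriv hdiff hx.1.continuousWithinAt (Ioo_mem_nhdsGT hu) hlim
  -- both sides are the limit of the slope of `x` at `τ`
  have heq : deriv A τ / m + B τ = m := by
    have h1 := (hasDerivWithinAt_iff_tendsto_slope' self_notMem_Ioi).1
      (hright.mono Ioi_subset_Ici_self)
    refine tendsto_nhds_unique h1 (hm.congr fun t => ?_)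
    rw [slope_def_field, hxτ, sub_zero]
  rw [heq] at hlim hright
  refine ⟨m, hlim, hright, ?_, fun hpos => ?_, fun hneg => ⟨?_, ?_⟩⟩
  · field_simp at heq
    linarith
  · refine lt_of_le_of_ne (le_of_tendsto hm ?_) hm0
    filter_upwards [hIoo, hα.eventually_const_lt hpos] with t ht h1
    have h0 := sub_pos.2 ht.1
    have hAt : 0 < A t := (div_pos_iff_of_pos_right h0).1 h1
    exact (div_neg_of_neg_of_pos (sx.neg_of_pos hAt) h0).le
  · refine lt_of_le_of_ne (ge_of_tendsto hm ?_) hm0.symm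
    filter_upwards [hIoo, hα.eventually_lt_const hneg] with t ht h1
    have h0 := sub_pos.2 ht.1
    have hAt : A t < 0 := by
      by_contra! h
      exact absurd h1 (not_lt.2 (div_nonneg h h0.le))
    exact (div_pos (sx.pos_of_neg hAt) h0).le
  · refine le_of_tendsto hm ?_
    filter_upwards [Ioo_mem_nhdsGT (by linarith [D.T_pos] : τ < τ + T)] with t ht
    rw [div_le_iff₀ (sub_pos.2 ht.1)]
    exact D.le_ray hx hτ.ge ht.1.le ht.2 le_rfl (by rw [hp τ, hxτ])

theorem contDiff_of_simple_zeros (D : PeriodicData T μ β c l A B C) (hx : IsSolution A B C x)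
    (hp : Function.Periodic x T) (sx : HasSignOf x (fun t => -A t))
    (hs : ∀ t, A t = 0 → deriv A t ≠ 0) : ContDiff ℝ 1 x := by
  have hzero : ∀ τ, A τ = 0 → ∃ m, HasDerivAt x m τ ∧ Tendsto (deriv x) (𝓝[≠] τ) (𝓝 m) := by
    intro τ hτ
    obtain ⟨m, hm, hd, heq, hsad, hnode⟩ := D.exists_right_deriv hx hp sx hτ (hs τ hτ)
    have hderiv : deriv (fun t => -A (-t)) (-τ) = deriv A τ := by rw [deriv_reflect, neg_neg]
    obtain ⟨m', hm', hd', heq', hsad', hnode'⟩ := D.reflect.exists_right_deriv hx.reflect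
      (fun t => congrArg Neg.neg (periodic_reflect hp t)) sx.reflect (τ := -τ) (by simpa using hτ)
      (by rw [hderiv]; exact hs τ hτ)
    rw [hderiv, neg_neg] at heq'
    rw [hderiv] at hsad' hnode'
    have hroots : (m - m') * (m + m' - B τ) = 0 := by linear_combination heq - heq'
    have hmm : m' = m := by
      rcases mul_eq_zero.1 hroots with h | h
      · linarith
      · have hprod : m * m' = -deriv A τ := by
          linear_combination m * h - heq
        rcases (hs τ hτ).lt_or_gt with h0 | h0
        · -- two distinct roots in `(0, l]` would make the characteristic polynomial nonnegative at `l`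
          obtain ⟨h1, h2⟩ := hnode h0
          obtain ⟨h3, h4⟩ := hnode' h0
          have h5 := mul_nonneg (sub_nonneg.2 h2) (sub_nonneg.2 h4)
          have h6 := mul_le_mul_of_nonneg_right (D.le_B τ) D.l_pos.le
          have h7 : 0 ≤ l ^ 2 * (c * T) :=
            mul_nonneg (sq_nonneg l) (mul_nonneg D.c_nonneg D.T_pos.le)
          have h8 := D.quad
          have h9 := D.deriv_ge τ
          have h10 : (l - m) * (l - m') = l ^ 2 - B τ * l - deriv A τ := by
            linear_combination hprod - l * h
          linarith
        · have := mul_pos_of_neg_of_neg (hsad h0) (hsad' h0)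
          linarith
    subst hmm
    have hneg : (fun t => -(fun t => -x (-t)) (-t)) = x := by
      funext t
      simp
    have hleft : HasDerivWithinAt x m' (Iic τ) τ := by
      have h1 : HasDerivWithinAt (fun t : ℝ => -t) (-1) (Iic τ) τ :=
        (hasDerivAt_neg τ).hasDerivWithinAt
      have h2 := (hd'.scomp τ h1 fun t (ht : t ≤ τ) => mem_Ici.2 (neg_le_neg ht)).fun_neg
      simpa [Function.comp_def] using h2
    have hderivx : ∀ t, deriv (fun s => -x (-s)) (-t) = deriv x t := fun t => by
      rw [deriv_reflect, neg_neg]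
    have hlim : Tendsto (deriv x) (𝓝[<] τ) (𝓝 m') :=
      (hm'.comp (tendsto_neg_nhdsLT (a := τ))).congr hderivx
    refine ⟨m', ?_, ?_⟩
    · have := hleft.union hd
      rwa [Iic_union_Ici, hasDerivWithinAt_univ] at this
    · rw [← Iio_union_Ioi, nhdsWithin_union]
      exact hlim.sup hm
  rw [contDiff_one_iff_deriv]
  refine ⟨fun t => ?_, continuous_iff_continuousAt.2 fun t => ?_⟩
  · by_cases h : A t = 0
    · obtain ⟨m, hm, -⟩ := hzero t h
      exact hm.differentiableAt
    · exact (hx.hasDerivAt (sx.ne_zero h)).differentiableAt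
  · by_cases h : A t = 0
    · obtain ⟨m, hm, hlim⟩ := hzero t h
      rw [continuousAt_iff_punctured_nhds, hm.deriv]
      exact hlim
    · have hc : ContinuousAt (fun s => A s / x s + B s + C s * x s) t :=
        ((D.contA.continuousAt.div hx.1.continuousAt (sx.ne_zero h)).add
          D.contB.continuousAt).add (D.contC.continuousAt.mul hx.1.continuousAt)
      refine hc.congr ?_
      filter_upwards [D.contA.continuousAt.eventually_ne h] with s hs'
      exact (hx.hasDerivAt (sx.ne_zero hs')).deriv.symm

end PeriodicData

/-! ### The constants, and both signs of `B` -/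

/-- The discriminant condition provides the constants of `PeriodicData` when `B > 0`; the slope `l` is the
minimiser of `r ↦ r² (1 + c T) - β r + μ`. -/
theorem exists_periodicData {T : ℝ} (hT : 0 < T) {A B C : ℝ → ℝ}
    (hA : ContDiff ℝ 1 A) (hB : Continuous B) (hC : Continuous C)
    (hAT : Function.Periodic A T) (hBT : Function.Periodic B T) (hCT : Function.Periodic C T)
    (hzero : ∃ t, A t = 0) (hBpos : ∀ t, 0 < B t)
    (hcond : (⨅ t : ℝ, |B t| ^ 2) > -4 * (⨅ t : ℝ, deriv A t) * (1 + T * ⨆ t : ℝ, |C t|))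
    (hinf : 0 < ⨅ t : ℝ, |B t| ^ 2) (hA'bdd : BddBelow (range (deriv A))) :
    ∃ μ β c l, PeriodicData T μ β c l A B C := by
  obtain ⟨N, hN⟩ := (hCT.isBounded_of_continuous hT.ne' hC).exists_norm_le
  have hCbdd : BddAbove (range fun t => |C t|) :=
    ⟨N, forall_mem_range.2 fun t => hN _ ⟨t, rfl⟩⟩
  have hBbdd : BddBelow (range fun t => |B t| ^ 2) :=
    ⟨0, forall_mem_range.2 fun t => by positivity⟩
  have hc : 0 ≤ ⨆ t : ℝ, |C t| := (abs_nonneg _).trans (le_ciSup hCbdd 0)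
  set c := ⨆ t : ℝ, |C t|
  set I := ⨅ t : ℝ, |B t| ^ 2
  set m := ⨅ t : ℝ, deriv A t
  have hβ : 0 < √I := Real.sqrt_pos.2 hinf
  have hβsq : √I ^ 2 = I := Real.sq_sqrt hinf.le
  have hD : 0 < 1 + c * T := by positivity
  refine ⟨-m, √I, c, √I / (2 * (1 + c * T)), ?_⟩
  refine ⟨hT, hβ, hc, by positivity, hA, hB, hC, hAT, hBT, hCT, hzero,
    fun t => ?_, fun t => ?_, fun t => le_ciSup hCbdd t, ?_⟩
  · rw [neg_neg]
    exact ciInf_le hA'bdd t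
  · refine Real.sqrt_le_iff.2 ⟨(hBpos t).le, ?_⟩
    exact (ciInf_le hBbdd t).trans_eq (sq_abs (B t))
  · have h1 : (√I / (2 * (1 + c * T))) ^ 2 * (1 + c * T) = I / (4 * (1 + c * T)) := by
      rw [div_pow, hβsq]
      field_simp
      ring
    have h2 : √I * (√I / (2 * (1 + c * T))) = 2 * (I / (4 * (1 + c * T))) := by
      rw [← mul_div_assoc, ← sq, hβsq]
      field_simp
      ring
    have h3 : -m < I / (4 * (1 + c * T)) := by
      rw [lt_div_iff₀ (by positivity)]
      linarith
    rw [h1, h2]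
    linarith

namespace PeriodicData

variable {T μ β c l : ℝ} {A B C : ℝ → ℝ}

theorem existsUnique_solution (D : PeriodicData T μ β c l A B C)
    (hs : ∀ t, A t = 0 → deriv A t ≠ 0) :
    ∃! x : ℝ → ℝ, ContDiff ℝ 1 x ∧ IsSolution A B C x ∧ Function.Periodic x T ∧
      HasNonconstantSign x := by
  obtain ⟨x, hx, hp, sx⟩ := D.exists_solution
  refine ⟨x, ⟨D.contDiff_of_simple_zeros hx hp sx hs, hx, hp, ?_⟩, ?_⟩
  · obtain ⟨t, ht⟩ := D.zero
    exact ⟨t, sx.zero_of_zero ht⟩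
  · rintro y ⟨-, hy, hyp, hyz⟩
    exact D.solution_unique hy hx (D.sign_eq hy hyp hyz) sx

end PeriodicData

theorem theorem2 (T : ℝ) (hT : 0 < T) (A B C : ℝ → ℝ)
    (hA : ContDiff ℝ 1 A) (hB : ContDiff ℝ 1 B) (hC : ContDiff ℝ 1 C)
    (hAT : Function.Periodic A T) (hBT : Function.Periodic B T) (hCT : Function.Periodic C T)
    (hzero : ∃ t ∈ Set.Icc 0 T, A t = 0)
    (hcond : (⨅ t : ℝ, |B t| ^ 2) > -4 * (⨅ t : ℝ, deriv A t) * (1 + T * ⨆ t : ℝ, |C t|)) :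
    (∀ x : ℝ → ℝ, IsSolution A B C x → Function.Periodic x T → HasNonconstantSign x →
      HasSignOf x (fun t => -(A t * B t))) ∧
    ((∀ t : ℝ, A t = 0 → deriv A t ≠ 0) →
      ∃! x : ℝ → ℝ, ContDiff ℝ 1 x ∧ IsSolution A B C x ∧ Function.Periodic x T ∧
        HasNonconstantSign x) := by
  have hz : ∃ t, A t = 0 := hzero.imp fun _ h => h.2
  have hA'bdd : BddBelow (range (deriv A)) :=
    ((periodic_deriv hAT).isBounded_of_continuous hT.ne' (hA.continuous_deriv le_rfl)).bddBelow
  have hm : (⨅ t : ℝ, deriv A t) ≤ 0 := by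
    obtain ⟨t, -, ht⟩ := exists_deriv_eq_zero hT hA.continuous.continuousOn
      (by simpa using (hAT 0).symm)
    exact ht ▸ ciInf_le hA'bdd t
  have hinf : 0 < ⨅ t : ℝ, |B t| ^ 2 := by
    refine lt_of_le_of_lt ?_ hcond
    have : 0 ≤ ⨆ t : ℝ, |C t| := Real.iSup_nonneg fun t => abs_nonneg _
    exact mul_nonneg (by linarith) (by positivity)
  have hB0 : ∀ t, B t ≠ 0 := by
    intro t ht
    have := ciInf_le (f := fun t => |B t| ^ 2) ⟨0, forall_mem_range.2 fun t => by positivity⟩ t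
    simp only [ht, abs_zero, ne_eq, two_ne_zero, not_false_eq_true, zero_pow] at this
    exact hinf.not_ge this
  have hBsign : (∀ t, 0 < B t) ∨ ∀ t, B t < 0 := by
    by_contra! h
    obtain ⟨⟨s, hs⟩, t, ht⟩ := h
    obtain ⟨r, hr⟩ := mem_range_of_exists_le_of_exists_ge hB.continuous ⟨s, hs⟩ ⟨t, ht⟩
    exact hB0 r hr
  rcases hBsign with hpos | hneg
  · obtain ⟨μ, β, c, l, D⟩ := exists_periodicData hT hA hB.continuous hC.continuous hAT hBT hCT hz
      hpos hcond hinf hA'bdd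
    refine ⟨fun x hx hp hxz t => ?_, D.existsUnique_solution⟩
    rw [D.sign_eq hx hp hxz t]
    simp only [← neg_mul, sign_mul, sign_pos (hpos t), mul_one]
  · obtain ⟨μ, β, c, l, D⟩ := exists_periodicData (B := fun t => -B t) hT hA hB.continuous.neg
      hC.continuous hAT (fun t => congrArg Neg.neg (hBT t)) hCT hz (fun t => neg_pos.2 (hneg t))
      (by simpa only [abs_neg] using hcond) (by simpa only [abs_neg] using hinf) hA'bdd
    refine ⟨fun x hx hp hxz t => ?_, fun hs => ?_⟩
    · obtain ⟨z, hz⟩ := hxz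
      have := D.sign_eq hx.neg (fun t => congrArg Neg.neg (hp t)) ⟨z, by simp [hz]⟩ t
      rw [Left.sign_neg, Left.sign_neg, neg_inj] at this
      rw [this]
      simp only [← mul_neg, sign_mul, sign_pos (neg_pos.2 (hneg t)), mul_one]
    · obtain ⟨x, ⟨h1, h2, h3, t, h4⟩, huniq⟩ := D.existsUnique_solution hs
      refine ⟨fun t => -x t, ⟨h1.neg, ?_, fun t => congrArg Neg.neg (h3 t), t, by simp [h4]⟩, ?_⟩
      · simpa using h2.neg
      · rintro y ⟨g1, g2, g3, s, g4⟩
        have := huniq (fun t => -y t)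
          ⟨g1.neg, g2.neg, fun t => congrArg Neg.neg (g3 t), s, by simp [g4]⟩
        rw [← this]
        simp
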